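/- Let $\mathbb{D}$ be the open unit disc and let $\lambda$ be the normalized Lebesgue measure on the unit circle $\partial\mathbb{D}$. Let $f\colon \mathbb{D}\to\mathbb{D}$ be an inner function, that is, a holomorphic map such that for $\lambda$-almost every $\xi\in\partial\mathbb{D}$ the radial limit $f(\xi):=\lim_{r\to1^-} f(r\xi)$ exists and has modulus $1$. Let $p\in\partial\mathbb{D}$ be a boundary Fatou point of $f$, that is, $f(p)=\lim_{r\to 1^-}f(rp)$ exists and $f(p)\in\partial\mathbb{D}$. For $\beta>1$ let $\Gamma_\beta(p)=\{z\in\mathbb{D}: |z-p|<\beta(1-|z|)\}$. If for some $\eta\in\partial\mathbb{D}$ and some $\beta>1$ the limit $f'(p):=\lim_{\Gamma_\beta(p)\ni z\to p}\frac{\eta-f(z)}{p-z}$ exists and is finite, then $f$ is said to have the finite angular derivative $f'(p)$ at $p$; otherwise put $|f'(p)|=\infty$. For $a\in\partial\mathbb{D}$ and measurable $A\subseteq\partial\mathbb{D}$ let $\mu_a(A)=\int_A |\xi-a|^{-2}\,d\lambda(\xi)\in[0,\infty]$, and for $E\subseteq\partial\mathbb{D}$ let $f^{-1}(E)$ be the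 set of all $\xi\in\partial\mathbb{D}$ at which the radial limit $f(\xi)$ exists and belongs to $E$. Then, for every (Lebesgue) measurable set $E\subseteq\partial\mathbb{D}$, the set $f^{-1}(E)$ is measurable, and: (a) if $|f'(p)|<\infty$, then $\mu_p(f^{-1}(E))=|f'(p)|\,\mu_{f(p)}(E)$; (b) if $|f'(p)|=\infty$, then $\mu_p(f^{-1}(E))=\infty$ whenever $\mu_{f(p)}(E)>0$, and $\mu_p(f^{-1}(E))=0$ whenever $\mu_{f(p)}(E)=0$. -/

import Mathlib

open Filter Topology MeasureTheory Metric
open scoped ENNReal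

noncomputable section

namespace InnerFun

/-- `w` is the radial limit of `f` at `ξ`, that is `f (r ξ) → w` as `r → 1⁻`. -/
def HasRadialLimit (f : ℂ → ℂ) (ξ w : ℂ) : Prop :=
  Tendsto (fun r : ℝ => f ((r : ℂ) * ξ)) (𝓝[<] (1 : ℝ)) (𝓝 w)

/-- Normalized Lebesgue (arc length) measure on the unit circle, regarded as a Borel measure
on `ℂ` carried by the unit circle. -/
def lebCircle : Measure ℂ :=
  (ENNReal.ofReal (2 * Real.pi))⁻¹ •
    (volume.restrict (Set.Ioc 0 (2 * Real.pi))).map (circleMap 0 1)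

/-- An inner function: a holomorphic self map of the open unit disc (the values of `f` outside
the disc are irrelevant) having a unimodular radial limit at almost every point of the circle. -/
structure IsInner (f : ℂ → ℂ) : Prop where
  differentiableOn : DifferentiableOn ℂ f (ball 0 1)
  mapsTo : Set.MapsTo f (ball 0 1) (ball 0 1)
  radial : ∀ᵐ ξ ∂lebCircle, ∃ w ∈ sphere (0 : ℂ) 1, HasRadialLimit f ξ w

/-- The preimage of `E` under the boundary map `ξ ↦ lim_{r → 1} f (r ξ)`, which is defined at
those points of the circle where this limit exists. -/
def boundaryPreimage (f : ℂ → ℂ) (E : Set ℂ) : Set ℂ :=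
  {ξ | ξ ∈ sphere (0 : ℂ) 1 ∧ ∃ w ∈ E, HasRadialLimit f ξ w}

/-- The Stolz angle with vertex `p` and opening `β`; it is nonempty exactly when `1 < β`
(for `p` on the unit circle). -/
def stolzAngle (β : ℝ) (p : ℂ) : Set ℂ :=
  {z | z ∈ ball (0 : ℂ) 1 ∧ ‖z - p‖ < β * (1 - ‖z‖)}

/-- `d` is the (finite) angular derivative of `f` at the boundary point `p`. -/
def HasAngularDeriv (f : ℂ → ℂ) (p d : ℂ) : Prop :=
  ∃ η ∈ sphere (0 : ℂ) 1, ∃ β : ℝ, 1 < β ∧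
    Tendsto (fun z => (η - f z) / (p - z)) (𝓝[stolzAngle β p] p) (𝓝 d)

open Classical in
/-- The modulus `|f'(p)|` of the angular derivative, equal to `∞` if there is no finite angular
derivative at `p`. -/
def absAngularDeriv (f : ℂ → ℂ) (p : ℂ) : ℝ≥0∞ :=
  if h : ∃ d, HasAngularDeriv f p d then ‖h.choose‖ₑ else ∞

/-- The measure `μ_p(E) = ∫_E |ξ - p|⁻² dλ(ξ)`. -/
def muMeasure (p : ℂ) : Measure ℂ :=
  lebCircle.withDensity fun ξ => (‖ξ - p‖ₑ ^ 2)⁻¹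

end InnerFun

end

/-!
Löwner's lemma says that the boundary map of an inner function transports the harmonic measure of
the disc seen from `z` to the one seen from `f z`, because both have the moments `f z ^ n`. Divided
by `1 - ‖z‖ ^ 2`, it reads `μ_z (f⁻¹ E) = (1 - ‖f z‖ ^ 2) / (1 - ‖z‖ ^ 2) * μ_{f z} (E)`, and the
claim follows by letting `z → p` along the radius. The left side converges by dominated convergence
in a Stolz angle. The Julia quotient on the right side tends to `|f'(p)|`: by the Schwarz–Pick
inequality for functions with nonnegative real part, `(p - z) / (η - f z)` always has an angular
limit at `p`, of modulus the atom of the Clark measure of `f` at `η`. If `|f'(p)|` is finite, `f`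
maps the radius into a Stolz angle, so `μ_{f z} (E)` converges too; if it is infinite, lower
semicontinuity of `z ↦ μ_z (E)` is enough.
-/

open scoped ComplexConjugate

namespace InnerFun

/-! ### The Schwarz–Pick inequality -/

lemma sq_norm_add_conj (a b : ℂ) : ‖a + conj b‖ ^ 2 = ‖a - b‖ ^ 2 + 4 * a.re * b.re := by
  simp only [Complex.sq_norm, Complex.normSq_apply, Complex.add_re, Complex.add_im,
    Complex.sub_re, Complex.sub_im, Complex.conj_re, Complex.conj_im]
  ring

lemma sq_norm_one_sub_conj_mul (w z : ℂ) :
    ‖1 - conj w * z‖ ^ 2 = ‖z - w‖ ^ 2 + (1 - ‖z‖ ^ 2) * (1 - ‖w‖ ^ 2) := by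
  simp only [Complex.sq_norm, Complex.normSq_apply, Complex.mul_re, Complex.mul_im,
    Complex.sub_re, Complex.sub_im, Complex.conj_re, Complex.conj_im, Complex.one_re,
    Complex.one_im]
  ring

lemma one_sub_sq_norm_pos {z : ℂ} (hz : z ∈ ball (0 : ℂ) 1) : 0 < 1 - ‖z‖ ^ 2 :=
  sub_pos.2 (pow_lt_one₀ (norm_nonneg z) (mem_ball_zero_iff.1 hz) two_ne_zero)

lemma norm_sub_lt_norm_one_sub_conj_mul {w z : ℂ} (hw : w ∈ ball (0 : ℂ) 1)
    (hz : z ∈ ball (0 : ℂ) 1) : ‖z - w‖ < ‖1 - conj w * z‖ := by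
  refine lt_of_pow_lt_pow_left₀ 2 (norm_nonneg _) ?_
  rw [sq_norm_one_sub_conj_mul]
  exact lt_add_of_pos_right _ (mul_pos (one_sub_sq_norm_pos hz) (one_sub_sq_norm_pos hw))

lemma one_sub_conj_mul_ne_zero {w z : ℂ} (hw : w ∈ ball (0 : ℂ) 1) (hz : z ∈ ball (0 : ℂ) 1) :
    1 - conj w * z ≠ 0 :=
  norm_pos_iff.1 ((norm_nonneg _).trans_lt (norm_sub_lt_norm_one_sub_conj_mul hw hz))

/-- The automorphism of the unit disc that sends `w` to `0`, with inverse `discAut (-w)`. -/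
noncomputable def discAut (w z : ℂ) : ℂ := (z - w) / (1 - conj w * z)

lemma mapsTo_discAut {w : ℂ} (hw : w ∈ ball (0 : ℂ) 1) :
    Set.MapsTo (discAut w) (ball 0 1) (ball 0 1) := fun z hz => by
  rw [mem_ball_zero_iff, discAut, norm_div,
    div_lt_one (norm_pos_iff.2 (one_sub_conj_mul_ne_zero hw hz))]
  exact norm_sub_lt_norm_one_sub_conj_mul hw hz

lemma differentiableOn_discAut {w : ℂ} (hw : w ∈ ball (0 : ℂ) 1) :
    DifferentiableOn ℂ (discAut w) (ball 0 1) :=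
  DifferentiableOn.div (by fun_prop) (by fun_prop) fun _ hz => one_sub_conj_mul_ne_zero hw hz

lemma neg_mem_unitBall {w : ℂ} (hw : w ∈ ball (0 : ℂ) 1) : -w ∈ ball (0 : ℂ) 1 := by
  simpa using hw

lemma discAut_neg_discAut {w z : ℂ} (hw : w ∈ ball (0 : ℂ) 1) (hz : z ∈ ball (0 : ℂ) 1) :
    discAut (-w) (discAut w z) = z := by
  have hden : 1 - conj (-w) * discAut w z ≠ 0 :=
    one_sub_conj_mul_ne_zero (neg_mem_unitBall hw) (mapsTo_discAut hw hz)
  have hmul : discAut w z * (1 - conj w * z) = z - w :=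
    div_mul_cancel₀ _ (one_sub_conj_mul_ne_zero hw hz)
  rw [discAut, div_eq_iff hden, map_neg]
  linear_combination hmul

lemma norm_le_norm_discAut {φ : ℂ → ℂ} (hφ : DifferentiableOn ℂ φ (ball 0 1))
    (hmaps : Set.MapsTo φ (ball 0 1) (closedBall 0 1)) {z w : ℂ} (hz : z ∈ ball (0 : ℂ) 1)
    (hw : w ∈ ball (0 : ℂ) 1) (hφw : φ w = 0) : ‖φ z‖ ≤ ‖discAut w z‖ := by
  have hw' := neg_mem_unitBall hw
  have h := Complex.norm_le_norm_of_mapsTo_ball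
    (hφ.comp (differentiableOn_discAut hw') (mapsTo_discAut hw'))
    (hmaps.comp (mapsTo_discAut hw')) (by simpa [discAut] using hφw)
    (mem_ball_zero_iff.1 (mapsTo_discAut hw hz))
  rwa [Function.comp_apply, discAut_neg_discAut hw hz] at h

lemma mul_le_of_norm_div_le_norm_discAut {a b w z : ℂ} (hz : z ∈ ball (0 : ℂ) 1)
    (hw : w ∈ ball (0 : ℂ) 1) (hb : b ≠ 0) (h : ‖a / b‖ ≤ ‖discAut w z‖) :
    ‖a‖ ^ 2 * ((1 - ‖z‖ ^ 2) * (1 - ‖w‖ ^ 2)) ≤ ‖z - w‖ ^ 2 * (‖b‖ ^ 2 - ‖a‖ ^ 2) := by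
  rw [discAut, norm_div, norm_div, div_le_div_iff₀ (norm_pos_iff.2 hb)
    (norm_pos_iff.2 (one_sub_conj_mul_ne_zero hw hz))] at h
  have hsq := pow_le_pow_left₀ (by positivity) h 2
  rw [mul_pow, mul_pow, sq_norm_one_sub_conj_mul] at hsq
  linarith

lemma schwarz_pick {f : ℂ → ℂ} (hf : DifferentiableOn ℂ f (ball 0 1))
    (hm : Set.MapsTo f (ball 0 1) (ball 0 1)) {z w : ℂ} (hz : z ∈ ball (0 : ℂ) 1)
    (hw : w ∈ ball (0 : ℂ) 1) :
    ‖f z - f w‖ ^ 2 * ((1 - ‖z‖ ^ 2) * (1 - ‖w‖ ^ 2)) ≤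
      ‖z - w‖ ^ 2 * ((1 - ‖f z‖ ^ 2) * (1 - ‖f w‖ ^ 2)) := by
  have h := norm_le_norm_discAut ((differentiableOn_discAut (hm hw)).comp hf hm)
    (((mapsTo_discAut (hm hw)).comp hm).mono_right ball_subset_closedBall) hz hw
    (by simp [discAut])
  have key := mul_le_of_norm_div_le_norm_discAut hz hw
    (one_sub_conj_mul_ne_zero (hm hw) (hm hz)) h
  rwa [sq_norm_one_sub_conj_mul, add_sub_cancel_left] at key

lemma schwarz_pick_of_re_pos {K : ℂ → ℂ} (hK : DifferentiableOn ℂ K (ball 0 1))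
    (hpos : ∀ z ∈ ball (0 : ℂ) 1, 0 < (K z).re) {z w : ℂ} (hz : z ∈ ball (0 : ℂ) 1)
    (hw : w ∈ ball (0 : ℂ) 1) :
    ‖K z - K w‖ ^ 2 * ((1 - ‖z‖ ^ 2) * (1 - ‖w‖ ^ 2)) ≤
      ‖z - w‖ ^ 2 * (4 * (K z).re * (K w).re) := by
  have hden : ∀ u ∈ ball (0 : ℂ) 1, K u + conj (K w) ≠ 0 := fun u hu h => by
    have hre := congrArg Complex.re h
    simp only [Complex.add_re, Complex.conj_re, Complex.zero_re] at hre
    linarith [hpos u hu, hpos w hw]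
  have hmaps : Set.MapsTo (fun u => (K u - K w) / (K u + conj (K w))) (ball 0 1)
      (closedBall 0 1) := fun u hu => by
    rw [mem_closedBall_zero_iff, norm_div, div_le_one (norm_pos_iff.2 (hden u hu))]
    refine le_of_sq_le_sq ?_ (norm_nonneg _)
    rw [sq_norm_add_conj]
    nlinarith [mul_pos (hpos u hu) (hpos w hw)]
  have h := norm_le_norm_discAut ((hK.sub_const _).div (hK.add_const _) hden) hmaps hz hw
    (by simp)
  have key := mul_le_of_norm_div_le_norm_discAut hz hw (hden z hz) h
  rwa [sq_norm_add_conj, add_sub_cancel_left] at key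

lemma schwarz_pick_of_re_nonneg {K : ℂ → ℂ} (hK : DifferentiableOn ℂ K (ball 0 1))
    (hnn : ∀ z ∈ ball (0 : ℂ) 1, 0 ≤ (K z).re) {z w : ℂ} (hz : z ∈ ball (0 : ℂ) 1)
    (hw : w ∈ ball (0 : ℂ) 1) :
    ‖K z - K w‖ ^ 2 * ((1 - ‖z‖ ^ 2) * (1 - ‖w‖ ^ 2)) ≤
      ‖z - w‖ ^ 2 * (4 * (K z).re * (K w).re) := by
  have hcont : Continuous fun δ : ℝ => ‖z - w‖ ^ 2 * (4 * ((K z).re + δ) * ((K w).re + δ)) := by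
    fun_prop
  have hlim : Tendsto (fun δ : ℝ => ‖z - w‖ ^ 2 * (4 * ((K z).re + δ) * ((K w).re + δ)))
      (𝓝[>] 0) (𝓝 (‖z - w‖ ^ 2 * (4 * (K z).re * (K w).re))) := by
    simpa using (hcont.tendsto 0).mono_left nhdsWithin_le_nhds
  refine ge_of_tendsto hlim ?_
  filter_upwards [self_mem_nhdsWithin] with δ (hδ : 0 < δ)
  simpa using schwarz_pick_of_re_pos (K := fun z => K z + (δ : ℂ)) (hK.add_const _)
    (fun z hz => by simpa using add_pos_of_nonneg_of_pos (hnn z hz) hδ) hz hw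

/-! ### The Julia–Carathéodory theorem -/

lemma re_add_div_sub (a b : ℂ) :
    ((a + b) / (a - b)).re = (‖a‖ ^ 2 - ‖b‖ ^ 2) / ‖a - b‖ ^ 2 := by
  have h := congrFun (poissonKernel_eq_re_herglotzRieszKernel (c := 0) (w := b)) a
  simpa [poissonKernel_def, herglotzRieszKernel_def] using h.symm

lemma sub_ne_zero_of_mem_sphere_of_mem_ball {q w : ℂ} (hq : q ∈ sphere (0 : ℂ) 1)
    (hw : w ∈ ball (0 : ℂ) 1) : q - w ≠ 0 := fun h => by
  rw [← sub_eq_zero.1 h] at hw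
  exact (mem_ball.1 hw).ne hq

lemma norm_sub_le_of_mem_stolzAngle {β : ℝ} {p z : ℂ} (hz : z ∈ stolzAngle β p) :
    ‖p - z‖ ≤ β * (1 - ‖z‖ ^ 2) := by
  have hβ : 0 ≤ β * (1 - ‖z‖) := (norm_nonneg _).trans hz.2.le
  rw [norm_sub_rev]
  nlinarith [hz.2, mul_nonneg hβ (norm_nonneg z)]

lemma sq_norm_mul_sub_le_of_re_nonneg {L : ℂ → ℂ} (hL : DifferentiableOn ℂ L (ball 0 1))
    (hnn : ∀ z ∈ ball (0 : ℂ) 1, 0 ≤ (L z).re) {p z w : ℂ} (hz : z ∈ ball (0 : ℂ) 1)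
    (hw : w ∈ ball (0 : ℂ) 1) {B ε : ℝ} (hB : ‖p - z‖ ≤ B * (1 - ‖z‖ ^ 2))
    (hε : (L w).re * ‖z - w‖ ^ 2 ≤ ε * (1 - ‖w‖ ^ 2)) :
    ‖(L z - L w) * (p - z)‖ ^ 2 ≤ 4 * B * ε * ‖L z * (p - z)‖ := by
  have hz1 := one_sub_sq_norm_pos hz
  have hw1 := one_sub_sq_norm_pos hw
  have hB0 : 0 ≤ B := nonneg_of_mul_nonneg_left ((norm_nonneg _).trans hB) hz1
  have : 0 ≤ ε :=
    nonneg_of_mul_nonneg_left ((mul_nonneg (hnn w hw) (sq_nonneg _)).trans hε) hw1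
  have hpick : ‖L z - L w‖ ^ 2 * (1 - ‖z‖ ^ 2) ≤ 4 * ε * ‖L z‖ := by
    refine le_of_mul_le_mul_right ?_ hw1
    calc ‖L z - L w‖ ^ 2 * (1 - ‖z‖ ^ 2) * (1 - ‖w‖ ^ 2)
        ≤ 4 * (L z).re * ((L w).re * ‖z - w‖ ^ 2) := by
          linarith [schwarz_pick_of_re_nonneg hL hnn hz hw]
      _ ≤ 4 * ‖L z‖ * (ε * (1 - ‖w‖ ^ 2)) := by
          gcongr
          · exact mul_nonneg (hnn w hw) (sq_nonneg _)
          · exact Complex.re_le_norm _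
      _ = 4 * ε * ‖L z‖ * (1 - ‖w‖ ^ 2) := by ring
  calc ‖(L z - L w) * (p - z)‖ ^ 2
      = ‖L z - L w‖ ^ 2 * ‖p - z‖ * ‖p - z‖ := by rw [norm_mul]; ring
    _ ≤ ‖L z - L w‖ ^ 2 * (B * (1 - ‖z‖ ^ 2)) * ‖p - z‖ := by gcongr
    _ = B * (‖L z - L w‖ ^ 2 * (1 - ‖z‖ ^ 2)) * ‖p - z‖ := by ring
    _ ≤ B * (4 * ε * ‖L z‖) * ‖p - z‖ := by gcongr
    _ = 4 * B * ε * ‖L z * (p - z)‖ := by rw [norm_mul]; ring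

lemma tendsto_mul_sub_zero_of_re_nonneg {L : ℂ → ℂ} (hL : DifferentiableOn ℂ L (ball 0 1))
    (hnn : ∀ z ∈ ball (0 : ℂ) 1, 0 ≤ (L z).re) {p : ℂ}
    (hinf : ∀ ε > 0, ∃ w ∈ ball (0 : ℂ) 1, (L w).re * ‖p - w‖ ^ 2 < ε * (1 - ‖w‖ ^ 2))
    (β : ℝ) : Tendsto (fun z => L z * (p - z)) (𝓝[stolzAngle β p] p) (𝓝 0) := by
  rw [NormedAddGroup.tendsto_nhds_zero]
  intro δ hδ
  set B : ℝ := |β| + 1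
  have hBpos : 0 < B := by positivity
  obtain ⟨w, hw, hwε⟩ := hinf (δ / (32 * B)) (by positivity)
  have hnear : ∀ᶠ z in 𝓝[stolzAngle β p] p,
      (L w).re * ‖z - w‖ ^ 2 < δ / (32 * B) * (1 - ‖w‖ ^ 2) := by
    have hc : ContinuousAt (fun z => (L w).re * ‖z - w‖ ^ 2) p := by fun_prop
    exact nhdsWithin_le_nhds (hc.eventually_lt continuousAt_const hwε)
  have hsmall : ∀ᶠ z in 𝓝[stolzAngle β p] p, ‖L w * (p - z)‖ < δ / 4 := by
    have hc : ContinuousAt (fun z => ‖L w * (p - z)‖) p := by fun_prop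
    exact nhdsWithin_le_nhds (hc.eventually_lt continuousAt_const (by simpa using hδ))
  filter_upwards [hnear, hsmall, self_mem_nhdsWithin] with z hzw he hz
  have hpz : ‖p - z‖ ≤ B * (1 - ‖z‖ ^ 2) := by
    refine (norm_sub_le_of_mem_stolzAngle hz).trans ?_
    have := (one_sub_sq_norm_pos hz.1).le
    gcongr
    exact (le_abs_self β).trans (le_add_of_nonneg_right zero_le_one)
  have hsq := sq_norm_mul_sub_le_of_re_nonneg hL hnn hz.1 hw hpz hzw.le
  rw [show 4 * B * (δ / (32 * B)) = δ / 8 by field_simp; norm_num] at hsq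
  have htri : ‖L z * (p - z)‖ ≤ ‖(L z - L w) * (p - z)‖ + ‖L w * (p - z)‖ := by
    simpa only [← add_mul, sub_add_cancel] using
      norm_add_le ((L z - L w) * (p - z)) (L w * (p - z))
  have hhalf : ‖(L z - L w) * (p - z)‖ < δ / 2 := by
    by_contra! h
    nlinarith
  linarith

/-- The mass at the boundary point `p` of the measure that represents, by the Herglotz formula, a
holomorphic function `K` with nonnegative real part on the unit disc: the largest multiple of the
Poisson kernel at `p` that is a minorant of `Re K`. -/
noncomputable def herglotzMass (K : ℂ → ℂ) (p : ℂ) : ℝ :=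
  ⨅ z : ball (0 : ℂ) 1, (K z).re * ‖p - z‖ ^ 2 / (1 - ‖(z : ℂ)‖ ^ 2)

lemma herglotzMass_mul_le {K : ℂ → ℂ} (hnn : ∀ z ∈ ball (0 : ℂ) 1, 0 ≤ (K z).re) (p : ℂ) {z : ℂ}
    (hz : z ∈ ball (0 : ℂ) 1) :
    herglotzMass K p * (1 - ‖z‖ ^ 2) ≤ (K z).re * ‖p - z‖ ^ 2 := by
  rw [← le_div_iff₀ (one_sub_sq_norm_pos hz)]
  refine ciInf_le ⟨0, Set.forall_mem_range.2 fun w => ?_⟩ (⟨z, hz⟩ : ball (0 : ℂ) 1)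
  exact div_nonneg (mul_nonneg (hnn w w.2) (sq_nonneg _)) (one_sub_sq_norm_pos w.2).le

lemma le_herglotzMass {K : ℂ → ℂ} {p : ℂ} {b : ℝ}
    (hb : ∀ z ∈ ball (0 : ℂ) 1, b * (1 - ‖z‖ ^ 2) ≤ (K z).re * ‖p - z‖ ^ 2) :
    b ≤ herglotzMass K p :=
  have : Nonempty (ball (0 : ℂ) 1) := (nonempty_ball.2 one_pos).to_subtype
  le_ciInf fun z => (le_div_iff₀ (one_sub_sq_norm_pos z.2)).2 (hb z z.2)

lemma tendsto_mul_sub_of_re_nonneg {K : ℂ → ℂ} (hK : DifferentiableOn ℂ K (ball 0 1))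
    (hnn : ∀ z ∈ ball (0 : ℂ) 1, 0 ≤ (K z).re) {p : ℂ} (hp : p ∈ sphere (0 : ℂ) 1) (β : ℝ) :
    Tendsto (fun z => K z * (p - z)) (𝓝[stolzAngle β p] p) (𝓝 (2 * herglotzMass K p * p)) := by
  set m := herglotzMass K p
  have hne : ∀ z ∈ ball (0 : ℂ) 1, p - z ≠ 0 := fun z =>
    sub_ne_zero_of_mem_sphere_of_mem_ball hp
  let L : ℂ → ℂ := fun z => K z - m * ((p + z) / (p - z))
  have hLd : DifferentiableOn ℂ L (ball 0 1) :=
    hK.sub ((DifferentiableOn.div (by fun_prop) (by fun_prop) hne).const_mul _)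
  have hLre : ∀ z ∈ ball (0 : ℂ) 1,
      (L z).re * ‖p - z‖ ^ 2 = (K z).re * ‖p - z‖ ^ 2 - m * (1 - ‖z‖ ^ 2) := fun z hz => by
    have := norm_ne_zero_iff.2 (hne z hz)
    simp only [L, Complex.sub_re, Complex.re_ofReal_mul, re_add_div_sub,
      mem_sphere_zero_iff_norm.1 hp]
    field_simp
  have hLnn : ∀ z ∈ ball (0 : ℂ) 1, 0 ≤ (L z).re := fun z hz => by
    refine nonneg_of_mul_nonneg_left ?_ (pow_pos (norm_pos_iff.2 (hne z hz)) 2)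
    rw [hLre z hz]
    exact sub_nonneg.2 (herglotzMass_mul_le hnn p hz)
  have hinf : ∀ ε > 0, ∃ w ∈ ball (0 : ℂ) 1, (L w).re * ‖p - w‖ ^ 2 < ε * (1 - ‖w‖ ^ 2) := by
    intro ε hε
    by_contra! h
    refine (lt_add_of_pos_right m hε).not_ge (le_herglotzMass fun z hz => ?_)
    linarith [h z hz, hLre z hz]
  have hkernel : Tendsto (fun z => (m : ℂ) * (p + z)) (𝓝[stolzAngle β p] p)
      (𝓝 (m * (p + p))) :=
    ((by fun_prop : Continuous fun z => (m : ℂ) * (p + z)).tendsto p).mono_left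
      nhdsWithin_le_nhds
  have hsum := (tendsto_mul_sub_zero_of_re_nonneg hLd hLnn hinf β).add hkernel
  rw [show (0 : ℂ) + m * (p + p) = 2 * m * p by ring] at hsum
  refine hsum.congr' ?_
  filter_upwards [self_mem_nhdsWithin] with z hz
  simp only [L, sub_mul, mul_assoc, div_mul_cancel₀ _ (hne z hz.1), sub_add_cancel]

/-- The atom at `p` of the Aleksandrov–Clark measure of `f` at the unimodular number `η`; its
reciprocal is the modulus of the angular derivative of `f` at `p` when `f` has the radial limit `η`
there. -/
noncomputable def clarkMass (f : ℂ → ℂ) (p η : ℂ) : ℝ :=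
  herglotzMass (fun z => (η + f z) / (η - f z)) p

lemma re_add_div_sub_nonneg {f : ℂ → ℂ} (hm : Set.MapsTo f (ball 0 1) (ball 0 1)) {η : ℂ}
    (hη : η ∈ sphere (0 : ℂ) 1) : ∀ z ∈ ball (0 : ℂ) 1, 0 ≤ ((η + f z) / (η - f z)).re :=
  fun z hz => by
    rw [re_add_div_sub, mem_sphere_zero_iff_norm.1 hη, one_pow]
    exact div_nonneg (one_sub_sq_norm_pos (hm hz)).le (sq_nonneg _)

lemma clarkMass_nonneg {f : ℂ → ℂ} (hm : Set.MapsTo f (ball 0 1) (ball 0 1)) (p : ℂ) {η : ℂ}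
    (hη : η ∈ sphere (0 : ℂ) 1) : 0 ≤ clarkMass f p η :=
  le_herglotzMass fun z hz => by
    rw [zero_mul]
    exact mul_nonneg (re_add_div_sub_nonneg hm hη z hz) (sq_nonneg _)

lemma le_clarkMass {f : ℂ → ℂ} (hm : Set.MapsTo f (ball 0 1) (ball 0 1)) {p η : ℂ}
    (hη : η ∈ sphere (0 : ℂ) 1) {b : ℝ} (hb : ∀ z ∈ ball (0 : ℂ) 1,
      b * (1 - ‖z‖ ^ 2) * ‖η - f z‖ ^ 2 ≤ (1 - ‖f z‖ ^ 2) * ‖p - z‖ ^ 2) :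
    b ≤ clarkMass f p η :=
  le_herglotzMass fun z hz => by
    have hne := sub_ne_zero_of_mem_sphere_of_mem_ball hη (hm hz)
    rw [re_add_div_sub, mem_sphere_zero_iff_norm.1 hη, one_pow, div_mul_eq_mul_div,
      le_div_iff₀ (pow_pos (norm_pos_iff.2 hne) 2)]
    exact hb z hz

lemma tendsto_sub_div_sub {f : ℂ → ℂ} (hf : DifferentiableOn ℂ f (ball 0 1))
    (hm : Set.MapsTo f (ball 0 1) (ball 0 1)) {p η : ℂ} (hp : p ∈ sphere (0 : ℂ) 1)
    (hη : η ∈ sphere (0 : ℂ) 1) (β : ℝ) :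
    Tendsto (fun z => (p - z) / (η - f z)) (𝓝[stolzAngle β p] p)
      (𝓝 (clarkMass f p η * p / η)) := by
  have hη0 : η ≠ 0 := ne_of_mem_sphere hη one_ne_zero
  have hne : ∀ z ∈ ball (0 : ℂ) 1, η - f z ≠ 0 := fun z hz =>
    sub_ne_zero_of_mem_sphere_of_mem_ball hη (hm hz)
  have hK := tendsto_mul_sub_of_re_nonneg (K := fun z => (η + f z) / (η - f z))
    ((hf.const_add η).div (hf.const_sub η) hne) (re_add_div_sub_nonneg hm hη) hp β
  have hsub : Tendsto (fun z => p - z) (𝓝[stolzAngle β p] p) (𝓝 (p - p)) :=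
    ((by fun_prop : Continuous fun z : ℂ => p - z).tendsto p).mono_left nhdsWithin_le_nhds
  -- `1 / (η - w) = ((η + w) / (η - w) + 1) / (2 η)`
  have h := (hK.add hsub).div_const (2 * η)
  rw [sub_self, add_zero, mul_assoc, mul_div_mul_left _ _ two_ne_zero] at h
  refine h.congr' ?_
  filter_upwards [self_mem_nhdsWithin] with z hz
  have := hne z hz.1
  field_simp
  ring

lemma julia_inequality {f : ℂ → ℂ} (hf : DifferentiableOn ℂ f (ball 0 1))
    (hm : Set.MapsTo f (ball 0 1) (ball 0 1)) {ι : Type*} {l : Filter ι} [l.NeBot] {ζ : ι → ℂ}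
    {p η : ℂ} (hζ : Tendsto ζ l (𝓝 p)) (hfζ : Tendsto (fun i => f (ζ i)) l (𝓝 η)) {M : ℝ}
    (hM : ∀ᶠ i in l, ζ i ∈ ball (0 : ℂ) 1 ∧ 1 - ‖f (ζ i)‖ ^ 2 ≤ M * (1 - ‖ζ i‖ ^ 2)) {z : ℂ}
    (hz : z ∈ ball (0 : ℂ) 1) :
    ‖η - f z‖ ^ 2 * (1 - ‖z‖ ^ 2) ≤ M * ((1 - ‖f z‖ ^ 2) * ‖p - z‖ ^ 2) := by
  refine le_of_tendsto_of_tendsto (((hfζ.sub_const (f z)).norm.pow 2).mul_const (1 - ‖z‖ ^ 2))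
    ((((hζ.sub_const z).norm.pow 2).const_mul (1 - ‖f z‖ ^ 2)).const_mul M) ?_
  filter_upwards [hM] with i ⟨hi, hiM⟩
  refine le_of_mul_le_mul_right ?_ (one_sub_sq_norm_pos hi)
  have hfz := (one_sub_sq_norm_pos (hm hz)).le
  calc ‖f (ζ i) - f z‖ ^ 2 * (1 - ‖z‖ ^ 2) * (1 - ‖ζ i‖ ^ 2)
      ≤ ‖ζ i - z‖ ^ 2 * (1 - ‖f z‖ ^ 2) * (1 - ‖f (ζ i)‖ ^ 2) := by
        linarith [schwarz_pick hf hm hi hz]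
    _ ≤ ‖ζ i - z‖ ^ 2 * (1 - ‖f z‖ ^ 2) * (M * (1 - ‖ζ i‖ ^ 2)) := by gcongr
    _ = M * ((1 - ‖f z‖ ^ 2) * ‖ζ i - z‖ ^ 2) * (1 - ‖ζ i‖ ^ 2) := by ring

lemma inv_le_clarkMass {f : ℂ → ℂ} (hf : DifferentiableOn ℂ f (ball 0 1))
    (hm : Set.MapsTo f (ball 0 1) (ball 0 1)) {ι : Type*} {l : Filter ι} [l.NeBot] {ζ : ι → ℂ}
    {p η : ℂ} (hη : η ∈ sphere (0 : ℂ) 1) (hζ : Tendsto ζ l (𝓝 p))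
    (hfζ : Tendsto (fun i => f (ζ i)) l (𝓝 η)) {M : ℝ} (hM0 : 0 < M)
    (hM : ∀ᶠ i in l, ζ i ∈ ball (0 : ℂ) 1 ∧ 1 - ‖f (ζ i)‖ ^ 2 ≤ M * (1 - ‖ζ i‖ ^ 2)) :
    M⁻¹ ≤ clarkMass f p η :=
  le_clarkMass hm hη fun z hz => by
    rw [mul_assoc, inv_mul_le_iff₀ hM0, mul_comm (1 - ‖z‖ ^ 2)]
    exact julia_inequality hf hm hζ hfζ hM hz

/-! ### The angular derivative along the radius -/

lemma mul_mem_ball {r : ℝ} (hr : r ∈ Set.Ioo 0 1) {ξ : ℂ} (hξ : ‖ξ‖ ≤ 1) :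
    (r : ℂ) * ξ ∈ ball (0 : ℂ) 1 := by
  rw [mem_ball_zero_iff, norm_mul, Complex.norm_of_nonneg hr.1.le]
  exact mul_lt_one_of_nonneg_of_lt_one_left hr.1.le hr.2 hξ

lemma hasRadialLimit_id (ξ : ℂ) : HasRadialLimit (fun z => z) ξ ξ := by
  have : Continuous fun r : ℝ => (r : ℂ) * ξ := by fun_prop
  simpa [HasRadialLimit] using (this.tendsto 1).mono_left nhdsWithin_le_nhds

lemma eventually_mul_mem_ball {p : ℂ} (hp : p ∈ sphere (0 : ℂ) 1) :
    ∀ᶠ r : ℝ in 𝓝[<] 1, (r : ℂ) * p ∈ ball (0 : ℂ) 1 := by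
  filter_upwards [Ioo_mem_nhdsLT zero_lt_one] with r hr
  exact mul_mem_ball hr (mem_sphere_zero_iff_norm.1 hp).le

lemma tendsto_radius_stolzAngle {p : ℂ} (hp : p ∈ sphere (0 : ℂ) 1) {β : ℝ} (hβ : 1 < β) :
    Tendsto (fun r : ℝ => (r : ℂ) * p) (𝓝[<] 1) (𝓝[stolzAngle β p] p) := by
  refine tendsto_nhdsWithin_iff.2 ⟨hasRadialLimit_id p, ?_⟩
  filter_upwards [eventually_mul_mem_ball hp, Ioo_mem_nhdsLT zero_lt_one] with r hrp hr
  have hdist : ‖(r : ℂ) * p - p‖ = 1 - r := by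
    rw [← sub_one_mul, norm_mul, mem_sphere_zero_iff_norm.1 hp, mul_one, norm_sub_rev,
      ← Complex.ofReal_one, ← Complex.ofReal_sub, Complex.norm_of_nonneg (sub_nonneg.2 hr.2.le)]
  refine ⟨hrp, ?_⟩
  rw [hdist, norm_mul, mem_sphere_zero_iff_norm.1 hp, mul_one, Complex.norm_of_nonneg hr.1.le]
  exact lt_mul_of_one_lt_left (sub_pos.2 hr.2) hβ

lemma hasRadialLimit_of_tendsto_div {f : ℂ → ℂ} {p η d : ℂ} (hp : p ∈ sphere (0 : ℂ) 1) {β : ℝ}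
    (hβ : 1 < β)
    (hd : Tendsto (fun z => (η - f z) / (p - z)) (𝓝[stolzAngle β p] p) (𝓝 d)) :
    HasRadialLimit f p η := by
  have hsub : Tendsto (fun r : ℝ => p - r * p) (𝓝[<] 1) (𝓝 (p - p)) :=
    (hasRadialLimit_id p).const_sub p
  have h := ((hd.comp (tendsto_radius_stolzAngle hp hβ)).mul hsub).const_sub η
  rw [sub_self, mul_zero, sub_zero] at h
  refine h.congr' ?_
  filter_upwards [eventually_mul_mem_ball hp] with r hr
  rw [Function.comp_apply, div_mul_cancel₀ _ (sub_ne_zero_of_mem_sphere_of_mem_ball hp hr),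
    sub_sub_cancel]

lemma norm_mul_clarkMass_eq_one {f : ℂ → ℂ} (hf : DifferentiableOn ℂ f (ball 0 1))
    (hm : Set.MapsTo f (ball 0 1) (ball 0 1)) {p η d : ℂ} (hp : p ∈ sphere (0 : ℂ) 1)
    (hη : η ∈ sphere (0 : ℂ) 1) {β : ℝ} (hβ : 1 < β)
    (hd : Tendsto (fun z => (η - f z) / (p - z)) (𝓝[stolzAngle β p] p) (𝓝 d)) :
    ‖d‖ * clarkMass f p η = 1 := by
  have hrad := tendsto_radius_stolzAngle hp hβ
  have hmul : d * (clarkMass f p η * p / η) = 1 := by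
    refine tendsto_nhds_unique (((hd.mul (tendsto_sub_div_sub hf hm hp hη β)).comp hrad).congr' ?_)
      (tendsto_const_nhds (f := 𝓝[<] (1 : ℝ)))
    filter_upwards [eventually_mul_mem_ball hp] with r hr
    rw [Function.comp_apply, div_mul_div_cancel₀ (sub_ne_zero_of_mem_sphere_of_mem_ball hp hr),
      div_self (sub_ne_zero_of_mem_sphere_of_mem_ball hη (hm hr))]
  simpa [mem_sphere_zero_iff_norm.1 hp, mem_sphere_zero_iff_norm.1 hη,
    abs_of_nonneg (clarkMass_nonneg hm p hη)] using congrArg norm hmul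

lemma tendsto_sub_div_sub_of_clarkMass_pos {f : ℂ → ℂ} (hf : DifferentiableOn ℂ f (ball 0 1))
    (hm : Set.MapsTo f (ball 0 1) (ball 0 1)) {p η : ℂ} (hp : p ∈ sphere (0 : ℂ) 1)
    (hη : η ∈ sphere (0 : ℂ) 1) (hc : 0 < clarkMass f p η) (β : ℝ) :
    Tendsto (fun z => (η - f z) / (p - z)) (𝓝[stolzAngle β p] p)
      (𝓝 (η / (clarkMass f p η * p))) := by
  have hne : (clarkMass f p η : ℂ) * p / η ≠ 0 :=
    div_ne_zero (mul_ne_zero (Complex.ofReal_ne_zero.2 hc.ne') (ne_of_mem_sphere hp one_ne_zero))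
      (ne_of_mem_sphere hη one_ne_zero)
  simpa only [inv_div] using (tendsto_sub_div_sub hf hm hp hη β).inv₀ hne

lemma absAngularDeriv_ne_top_of_clarkMass_pos {f : ℂ → ℂ} (hf : DifferentiableOn ℂ f (ball 0 1))
    (hm : Set.MapsTo f (ball 0 1) (ball 0 1)) {p η : ℂ} (hp : p ∈ sphere (0 : ℂ) 1)
    (hη : η ∈ sphere (0 : ℂ) 1) (hc : 0 < clarkMass f p η) : absAngularDeriv f p ≠ ∞ := by
  have h : ∃ d, HasAngularDeriv f p d :=
    ⟨_, η, hη, 2, one_lt_two, tendsto_sub_div_sub_of_clarkMass_pos hf hm hp hη hc 2⟩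
  rw [absAngularDeriv, dif_pos h]
  exact enorm_ne_top

lemma exists_absAngularDeriv_eq_ofReal_inv_clarkMass {f : ℂ → ℂ}
    (hf : DifferentiableOn ℂ f (ball 0 1)) (hm : Set.MapsTo f (ball 0 1) (ball 0 1)) {p : ℂ}
    (hp : p ∈ sphere (0 : ℂ) 1) (hfin : absAngularDeriv f p ≠ ∞) :
    ∃ η ∈ sphere (0 : ℂ) 1, HasRadialLimit f p η ∧ 0 < clarkMass f p η ∧
      absAngularDeriv f p = ENNReal.ofReal (clarkMass f p η)⁻¹ := by
  unfold absAngularDeriv at hfin ⊢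
  split_ifs at hfin ⊢ with h
  · obtain ⟨η, hη, β, hβ, hd⟩ := h.choose_spec
    have hmul := norm_mul_clarkMass_eq_one hf hm hp hη hβ hd
    refine ⟨η, hη, hasRadialLimit_of_tendsto_div hp hβ hd,
      (clarkMass_nonneg hm p hη).lt_of_ne' (right_ne_zero_of_mul_eq_one hmul), ?_⟩
    rw [← eq_inv_of_mul_eq_one_left hmul, ofReal_norm]
  · exact absurd rfl hfin

/-- The Julia quotient of a self map of the disc, whose lower limit at a boundary point is, by the
Julia–Carathéodory theorem, the modulus of the angular derivative. -/
noncomputable def juliaQuotient (f : ℂ → ℂ) (z : ℂ) : ℝ := (1 - ‖f z‖ ^ 2) / (1 - ‖z‖ ^ 2)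

lemma one_sub_sq_norm_eq {η : ℂ} (hη : η ∈ sphere (0 : ℂ) 1) (w : ℂ) :
    1 - ‖w‖ ^ 2 = 2 * (conj η * (η - w)).re - ‖η - w‖ * ‖η - w‖ := by
  rw [← one_pow 2, ← mem_sphere_zero_iff_norm.1 hη, ← pow_two]
  simp only [Complex.sq_norm, Complex.normSq_apply, Complex.mul_re, Complex.sub_re, Complex.sub_im,
    Complex.conj_re, Complex.conj_im]
  ring

lemma tendsto_sub_div_one_sub_sq_norm {f : ℂ → ℂ} (hf : DifferentiableOn ℂ f (ball 0 1))
    (hm : Set.MapsTo f (ball 0 1) (ball 0 1)) {p η : ℂ} (hp : p ∈ sphere (0 : ℂ) 1)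
    (hη : η ∈ sphere (0 : ℂ) 1) (hc : 0 < clarkMass f p η) :
    Tendsto (fun r : ℝ => (η - f (r * p)) / (1 - ‖(r : ℂ) * p‖ ^ 2 : ℝ)) (𝓝[<] 1)
      (𝓝 (η / (2 * clarkMass f p η))) := by
  have hp0 : p ≠ 0 := ne_of_mem_sphere hp one_ne_zero
  have hradial : Tendsto (fun r : ℝ => p / (1 + r)) (𝓝[<] 1) (𝓝 (p / (1 + (1 : ℝ)))) :=
    ContinuousAt.continuousWithinAt (by fun_prop (disch := norm_num))
  have h := ((tendsto_sub_div_sub_of_clarkMass_pos hf hm hp hη hc 2).comp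
    (tendsto_radius_stolzAngle hp one_lt_two)).mul hradial
  rw [show η / (clarkMass f p η * p) * (p / (1 + (1 : ℝ))) = η / (2 * clarkMass f p η) by
    push_cast; field_simp; norm_num] at h
  refine h.congr' ?_
  filter_upwards [Ioo_mem_nhdsLT zero_lt_one] with r hr
  rw [norm_mul, mem_sphere_zero_iff_norm.1 hp, mul_one, Complex.norm_of_nonneg hr.1.le,
    Function.comp_apply, div_mul_div_comm, ← one_sub_mul, mul_right_comm, mul_div_mul_right _ _ hp0]
  push_cast
  ring

lemma tendsto_juliaQuotient {f : ℂ → ℂ} (hf : DifferentiableOn ℂ f (ball 0 1))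
    (hm : Set.MapsTo f (ball 0 1) (ball 0 1)) {p η : ℂ} (hp : p ∈ sphere (0 : ℂ) 1)
    (hη : η ∈ sphere (0 : ℂ) 1) (hc : 0 < clarkMass f p η) :
    Tendsto (fun r : ℝ => juliaQuotient f (r * p)) (𝓝[<] 1) (𝓝 (clarkMass f p η)⁻¹) := by
  have hquot := tendsto_sub_div_one_sub_sq_norm hf hm hp hη hc
  have hη1 := mem_sphere_zero_iff_norm.1 hη
  have hzero : Tendsto (fun r : ℝ => ‖η - f (r * p)‖) (𝓝[<] 1) (𝓝 0) := by
    simpa using ((hasRadialLimit_of_tendsto_div hp one_lt_two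
      (tendsto_sub_div_sub_of_clarkMass_pos hf hm hp hη hc 2)).const_sub η).norm
  have h := (((Complex.continuous_re.tendsto _).comp (hquot.const_mul (conj η))).const_mul 2).sub
    (hzero.mul hquot.norm)
  rw [show 2 * (conj η * (η / (2 * clarkMass f p η))).re -
      0 * ‖η / (2 * (clarkMass f p η : ℂ))‖ = (clarkMass f p η)⁻¹ by
    rw [← mul_div_assoc, Complex.conj_mul', hη1]
    norm_cast
    field_simp
    ring] at h
  refine h.congr' ?_
  filter_upwards [eventually_mul_mem_ball hp] with r hr
  rw [juliaQuotient, one_sub_sq_norm_eq hη (f (r * p)), Function.comp_apply, ← mul_div_assoc,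
    Complex.div_ofReal_re, norm_div, Complex.norm_of_nonneg (one_sub_sq_norm_pos hr).le]
  ring

lemma tendsto_radius_stolzAngle_of_clarkMass_pos {f : ℂ → ℂ}
    (hf : DifferentiableOn ℂ f (ball 0 1)) (hm : Set.MapsTo f (ball 0 1) (ball 0 1)) {p η : ℂ}
    (hp : p ∈ sphere (0 : ℂ) 1) (hη : η ∈ sphere (0 : ℂ) 1) (hc : 0 < clarkMass f p η) :
    Tendsto (fun r : ℝ => f (r * p)) (𝓝[<] 1) (𝓝[stolzAngle 2 η] η) := by
  refine tendsto_nhdsWithin_iff.2 ⟨hasRadialLimit_of_tendsto_div hp one_lt_two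
    (tendsto_sub_div_sub_of_clarkMass_pos hf hm hp hη hc 2), ?_⟩
  have hlt : ‖η / (2 * (clarkMass f p η : ℂ))‖ < (clarkMass f p η)⁻¹ := by
    rw [norm_div, norm_mul, mem_sphere_zero_iff_norm.1 hη, Complex.norm_of_nonneg hc.le,
      Complex.norm_two, one_div, mul_inv]
    linarith [inv_pos.2 hc]
  filter_upwards [eventually_mul_mem_ball hp,
    (tendsto_sub_div_one_sub_sq_norm hf hm hp hη hc).norm.eventually_lt
      (tendsto_juliaQuotient hf hm hp hη hc) hlt] with r hr h
  refine ⟨hm hr, ?_⟩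
  rw [norm_div, Complex.norm_of_nonneg (one_sub_sq_norm_pos hr).le, juliaQuotient,
    div_lt_div_iff_of_pos_right (one_sub_sq_norm_pos hr), norm_sub_rev] at h
  nlinarith [sq_nonneg (1 - ‖f (r * p)‖)]

lemma exists_clarkMass_pos_of_frequently_juliaQuotient_le {f : ℂ → ℂ}
    (hf : DifferentiableOn ℂ f (ball 0 1)) (hm : Set.MapsTo f (ball 0 1) (ball 0 1)) {p : ℂ}
    (hp : p ∈ sphere (0 : ℂ) 1) {M : ℝ} (hM0 : 0 < M)
    (hM : ∃ᶠ r : ℝ in 𝓝[<] 1, juliaQuotient f (r * p) ≤ M) :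
    ∃ η ∈ sphere (0 : ℂ) 1, 0 < clarkMass f p η := by
  have := frequently_iff_neBot.1 hM
  obtain ⟨U, hle⟩ := Ultrafilter.exists_le (𝓝[<] 1 ⊓ 𝓟 {r : ℝ | juliaQuotient f (r * p) ≤ M})
  obtain ⟨hU, hUM⟩ := le_inf_iff.1 hle
  have hball : ∀ᶠ r : ℝ in (U : Filter ℝ), (r : ℂ) * p ∈ ball (0 : ℂ) 1 :=
    hU (eventually_mul_mem_ball hp)
  have hbound : ∀ᶠ r : ℝ in (U : Filter ℝ), (r : ℂ) * p ∈ ball (0 : ℂ) 1 ∧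
      1 - ‖f (r * p)‖ ^ 2 ≤ M * (1 - ‖(r : ℂ) * p‖ ^ 2) := by
    filter_upwards [hball, le_principal_iff.1 hUM] with r hr hrM
    exact ⟨hr, (div_le_iff₀ (one_sub_sq_norm_pos hr)).1 hrM⟩
  obtain ⟨η, -, hη⟩ := (isCompact_closedBall (0 : ℂ) 1).ultrafilter_le_nhds'
    (U.map fun r : ℝ => f (r * p)) (hball.mono fun r hr => ball_subset_closedBall (hm hr))
  have hζ : Tendsto (fun r : ℝ => (r : ℂ) * p) U (𝓝 p) := (hasRadialLimit_id p).mono_left hU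
  have hfζ : Tendsto (fun r : ℝ => f (r * p)) U (𝓝 η) := hη
  have hη1 : 1 - ‖η‖ ^ 2 = 0 := by
    refine tendsto_nhds_unique ((hfζ.norm.pow 2).const_sub 1) (squeeze_zero' (hball.mono fun r hr =>
      (one_sub_sq_norm_pos (hm hr)).le) (hbound.mono fun r hr => hr.2) ?_)
    simpa [mem_sphere_zero_iff_norm.1 hp] using ((hζ.norm.pow 2).const_sub 1).const_mul M
  have hηs : η ∈ sphere (0 : ℂ) 1 := by
    rw [mem_sphere_zero_iff_norm]
    exact (pow_eq_one_iff_of_nonneg (norm_nonneg η) two_ne_zero).1 (sub_eq_zero.1 hη1).symm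
  exact ⟨η, hηs, (inv_pos.2 hM0).trans_le (inv_le_clarkMass hf hm hηs hζ hfζ hM0 hbound)⟩

theorem tendsto_juliaQuotient_absAngularDeriv {f : ℂ → ℂ}
    (hf : DifferentiableOn ℂ f (ball 0 1)) (hm : Set.MapsTo f (ball 0 1) (ball 0 1)) {p : ℂ}
    (hp : p ∈ sphere (0 : ℂ) 1) :
    Tendsto (fun r : ℝ => ENNReal.ofReal (juliaQuotient f (r * p))) (𝓝[<] 1)
      (𝓝 (absAngularDeriv f p)) := by
  by_cases hfin : absAngularDeriv f p = ∞
  · rw [hfin, ENNReal.tendsto_nhds_top_iff_nnreal]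
    intro M
    by_contra hcon
    have hfreq : ∃ᶠ r : ℝ in 𝓝[<] 1, juliaQuotient f (r * p) ≤ M + 1 :=
      (not_eventually.1 hcon).mono fun r hr =>
        (ENNReal.ofReal_le_iff_le_toReal ENNReal.coe_ne_top).1 (not_lt.1 hr) |>.trans
          (le_add_of_nonneg_right zero_le_one)
    obtain ⟨η, hη, hc⟩ := exists_clarkMass_pos_of_frequently_juliaQuotient_le hf hm hp
      (by positivity) hfreq
    exact absAngularDeriv_ne_top_of_clarkMass_pos hf hm hp hη hc hfin
  · obtain ⟨η, hη, -, hc, heq⟩ := exists_absAngularDeriv_eq_ofReal_inv_clarkMass hf hm hp hfin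
    rw [heq]
    exact ENNReal.tendsto_ofReal (tendsto_juliaQuotient hf hm hp hη hc)

/-! ### Finite measures on the unit circle and their moments -/

lemma ext_of_integral_fourier {T : ℝ} [Fact (0 < T)] {μ ν : Measure (AddCircle T)}
    [IsFiniteMeasure μ] [IsFiniteMeasure ν]
    (h : ∀ n : ℤ, ∫ t, fourier n t ∂μ = ∫ t, fourier n t ∂ν) : μ = ν := by
  have hint (ρ : Measure (AddCircle T)) [IsFiniteMeasure ρ] (u : C(AddCircle T, ℂ)) :
      Integrable u ρ :=
    (BoundedContinuousFunction.mkOfCompact u).integrable ρ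
  refine ext_of_forall_mem_subalgebra_integral_eq_of_polish (𝕜 := ℂ)
    (A := (fourierSubalgebra (T := T)).comap
      (BoundedContinuousFunction.toContinuousMapStarₐ ℂ)) ?_ fun g hg => ?_
  · intro x y hxy
    obtain ⟨_, ⟨g, hg, rfl⟩, hgxy⟩ := fourierSubalgebra_separatesPoints hxy
    exact ⟨g, ⟨g, ⟨BoundedContinuousFunction.mkOfCompact g, hg, rfl⟩, rfl⟩, hgxy⟩
  · have hspan : (g : C(AddCircle T, ℂ)) ∈ Submodule.span ℂ (Set.range (@fourier T)) := by
      rw [← fourierSubalgebra_coe]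
      exact hg
    suffices ∀ u ∈ Submodule.span ℂ (Set.range (@fourier T)), ∫ t, u t ∂μ = ∫ t, u t ∂ν from
      this _ hspan
    intro u hu
    induction hu using Submodule.span_induction with
    | mem _ hu =>
      obtain ⟨n, rfl⟩ := hu
      exact h n
    | zero => simp
    | add u v _ _ hu hv =>
      simp only [ContinuousMap.add_apply]
      rw [integral_add (hint μ u) (hint μ v), integral_add (hint ν u) (hint ν v), hu, hv]
    | smul c u _ hu =>
      simp only [ContinuousMap.smul_apply]
      rw [integral_smul, integral_smul, hu]

lemma integral_zpow_neg {μ : Measure ℂ} (hμ : ∀ᵐ x ∂μ, x ∈ sphere (0 : ℂ) 1) (m : ℕ) :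
    ∫ x, x ^ (-(m : ℤ)) ∂μ = conj (∫ x, x ^ m ∂μ) := by
  rw [← integral_conj]
  refine integral_congr_ae ?_
  filter_upwards [hμ] with x hx
  rw [zpow_neg, zpow_natCast, map_pow, ← inv_pow,
    Complex.inv_eq_conj (mem_sphere_zero_iff_norm.1 hx)]

/-- The angular coordinate of a complex number, as an element of `ℝ / 2πℤ`. Finite measures on the
unit circle are transported along it to `AddCircle`, where Fourier analysis is available. -/
noncomputable def angle (x : ℂ) : AddCircle (2 * Real.pi) := (x.arg : AddCircle (2 * Real.pi))

lemma measurable_angle : Measurable angle :=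
  (AddCircle.continuous_mk' _).measurable.comp Complex.measurable_arg

lemma toCircle_angle {x : ℂ} (hx : x ∈ sphere (0 : ℂ) 1) :
    (AddCircle.toCircle (angle x) : ℂ) = x := by
  have hexp : Circle.exp x.arg = ⟨x, hx⟩ :=
    Circle.exp_arg ⟨x, _⟩
  rw [angle, AddCircle.toCircle_apply_mk, div_self Real.two_pi_pos.ne', one_mul, hexp]

lemma map_toCircle_map_angle {μ : Measure ℂ} (hμ : ∀ᵐ x ∂μ, x ∈ sphere (0 : ℂ) 1) :
    (μ.map angle).map (fun t => (AddCircle.toCircle t : ℂ)) = μ := by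
  have hcont : Continuous fun t : AddCircle (2 * Real.pi) => (AddCircle.toCircle t : ℂ) :=
    continuous_subtype_val.comp AddCircle.continuous_toCircle
  rw [Measure.map_map hcont.measurable measurable_angle, Measure.map_congr (g := id),
    Measure.map_id]
  exact hμ.mono fun x hx => toCircle_angle hx

lemma integral_fourier_map_angle {μ : Measure ℂ} (hμ : ∀ᵐ x ∂μ, x ∈ sphere (0 : ℂ) 1) (n : ℤ) :
    ∫ t, fourier n t ∂(μ.map angle) = ∫ x, x ^ n ∂μ := by
  rw [integral_map measurable_angle.aemeasurable (fourier n).continuous.aestronglyMeasurable]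
  refine integral_congr_ae ?_
  filter_upwards [hμ] with x hx
  rw [fourier_apply, AddCircle.toCircle_zsmul, Circle.coe_zpow, toCircle_angle hx]

lemma measure_ext_of_integral_pow {μ ν : Measure ℂ} [IsFiniteMeasure μ] [IsFiniteMeasure ν]
    (hμ : ∀ᵐ x ∂μ, x ∈ sphere (0 : ℂ) 1) (hν : ∀ᵐ x ∂ν, x ∈ sphere (0 : ℂ) 1)
    (h : ∀ n : ℕ, ∫ x, x ^ n ∂μ = ∫ x, x ^ n ∂ν) : μ = ν := by
  have : Fact (0 < 2 * Real.pi) := ⟨Real.two_pi_pos⟩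
  have hmap : μ.map angle = ν.map angle := by
    refine ext_of_integral_fourier fun n => ?_
    rw [integral_fourier_map_angle hμ, integral_fourier_map_angle hν]
    obtain ⟨m, rfl | rfl⟩ := n.eq_nat_or_neg
    · simpa only [zpow_natCast] using h m
    · rw [integral_zpow_neg hμ, integral_zpow_neg hν, h m]
  rw [← map_toCircle_map_angle hμ, ← map_toCircle_map_angle hν, hmap]

/-! ### Harmonic measures of the disc -/

lemma ae_mem_sphere : ∀ᵐ ξ ∂lebCircle, ξ ∈ sphere (0 : ℂ) 1 := by
  refine Measure.ae_smul_measure ?_ _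
  rw [ae_map_iff (p := (· ∈ sphere (0 : ℂ) 1)) (by fun_prop) isClosed_sphere.measurableSet]
  exact ae_of_all _ fun θ => by simp

instance : IsProbabilityMeasure lebCircle := by
  constructor
  rw [lebCircle, Measure.smul_apply, Measure.map_apply (by fun_prop) MeasurableSet.univ]
  simp only [Set.preimage_univ, Measure.restrict_apply, MeasurableSet.univ, Set.univ_inter,
    Real.volume_Ioc, sub_zero, smul_eq_mul]
  exact ENNReal.inv_mul_cancel (by simpa using Real.pi_pos) ENNReal.ofReal_ne_top

lemma measurable_inv_sq_enorm_sub (z : ℂ) : Measurable fun ξ : ℂ => (‖ξ - z‖ₑ ^ 2)⁻¹ := by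
  fun_prop

lemma muMeasure_absolutelyContinuous (z : ℂ) : muMeasure z ≪ lebCircle :=
  withDensity_absolutelyContinuous _ _

lemma lebCircle_absolutelyContinuous (z : ℂ) : lebCircle ≪ muMeasure z :=
  withDensity_absolutelyContinuous' (measurable_inv_sq_enorm_sub z).aemeasurable
    (ae_of_all _ fun _ => ENNReal.inv_ne_zero.2 (ENNReal.pow_ne_top enorm_ne_top))

/-- The harmonic measure of the unit disc seen from `z`, whose density with respect to arc length
is the Poisson kernel `(1 - ‖z‖ ^ 2) / ‖ξ - z‖ ^ 2`. -/
noncomputable def harmonicMeasure (z : ℂ) : Measure ℂ :=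
  ENNReal.ofReal (1 - ‖z‖ ^ 2) • muMeasure z

lemma harmonicMeasure_absolutelyContinuous (z : ℂ) : harmonicMeasure z ≪ lebCircle :=
  Measure.smul_absolutelyContinuous.trans (muMeasure_absolutelyContinuous z)

lemma harmonicMeasure_zero : harmonicMeasure 0 = lebCircle := by
  rw [harmonicMeasure, muMeasure, withDensity_congr_ae (g := 1), withDensity_one]
  · simp
  · filter_upwards [ae_mem_sphere] with ξ hξ
    rw [sub_zero, ← ofReal_norm, mem_sphere_zero_iff_norm.1 hξ]
    simp

lemma one_sub_norm_le_norm_sub {z ξ : ℂ} (hξ : ξ ∈ sphere (0 : ℂ) 1) : 1 - ‖z‖ ≤ ‖ξ - z‖ := by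
  simpa only [mem_sphere_zero_iff_norm.1 hξ] using norm_sub_norm_le ξ z

lemma isFiniteMeasure_muMeasure {z : ℂ} (hz : z ∈ ball (0 : ℂ) 1) :
    IsFiniteMeasure (muMeasure z) := by
  have hz1 : 0 < 1 - ‖z‖ := by simpa using hz
  refine isFiniteMeasure_withDensity (ne_of_lt ?_)
  calc ∫⁻ ξ, (‖ξ - z‖ₑ ^ 2)⁻¹ ∂lebCircle
      ≤ ∫⁻ _, (ENNReal.ofReal (1 - ‖z‖) ^ 2)⁻¹ ∂lebCircle := by
        refine lintegral_mono_ae ?_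
        filter_upwards [ae_mem_sphere] with ξ hξ
        rw [← ofReal_norm]
        gcongr
        exact one_sub_norm_le_norm_sub hξ
    _ < ∞ := by
        rw [lintegral_const, measure_univ, mul_one]
        exact ENNReal.inv_lt_top.2 (ENNReal.pow_pos (ENNReal.ofReal_pos.2 hz1) 2)

lemma isFiniteMeasure_harmonicMeasure {z : ℂ} (hz : z ∈ ball (0 : ℂ) 1) :
    IsFiniteMeasure (harmonicMeasure z) := by
  have := isFiniteMeasure_muMeasure hz
  exact ⟨ENNReal.mul_lt_top ENNReal.ofReal_lt_top (measure_lt_top _ _)⟩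

lemma aestronglyMeasurable_lebCircle {F : Type*} [TopologicalSpace F]
    [TopologicalSpace.PseudoMetrizableSpace F] {h : ℂ → F} (hh : ContinuousOn h (sphere 0 1)) :
    AEStronglyMeasurable h lebCircle := by
  have hr := hh.aestronglyMeasurable (μ := lebCircle) isClosed_sphere.measurableSet
  rwa [Measure.restrict_eq_self_of_ae_mem ae_mem_sphere] at hr

section PoissonFormula

variable {F : Type*} [NormedAddCommGroup F] [NormedSpace ℂ F]

lemma integral_lebCircle {h : ℂ → F} (hh : ContinuousOn h (sphere 0 1)) :
    ∫ ξ, h ξ ∂lebCircle = Real.circleAverage h 0 1 := by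
  have hne : (ENNReal.ofReal (2 * Real.pi))⁻¹ ≠ 0 := ENNReal.inv_ne_zero.2 ENNReal.ofReal_ne_top
  rw [lebCircle, integral_smul_measure, integral_map (by fun_prop)
      ((aestronglyMeasurable_lebCircle hh).mono_ac (Measure.absolutelyContinuous_smul hne)),
    Real.circleAverage_def, intervalIntegral.integral_of_le Real.two_pi_pos.le, ENNReal.toReal_inv,
    ENNReal.toReal_ofReal Real.two_pi_pos.le]

lemma integral_harmonicMeasure {z : ℂ} (hz : z ∈ ball (0 : ℂ) 1) (h : ℂ → F) :
    ∫ ξ, h ξ ∂harmonicMeasure z = ∫ ξ, (poissonKernel 0 z • h) ξ ∂lebCircle := by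
  have hlt : ∀ᵐ ξ ∂lebCircle, (‖ξ - z‖ₑ ^ 2)⁻¹ < ∞ := by
    filter_upwards [ae_mem_sphere] with ξ hξ
    exact ENNReal.inv_lt_top.2
      (ENNReal.pow_pos (enorm_pos.2 (sub_ne_zero_of_mem_sphere_of_mem_ball hξ hz)) 2)
  rw [harmonicMeasure, integral_smul_measure, muMeasure,
    integral_withDensity_eq_integral_toReal_smul (measurable_inv_sq_enorm_sub z) hlt,
    ← integral_smul]
  refine integral_congr_ae ?_
  filter_upwards [ae_mem_sphere] with ξ hξ
  simp only [Pi.smul_apply', poissonKernel_def, sub_zero, mem_sphere_zero_iff_norm.1 hξ, one_pow,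
    smul_smul]
  rw [ENNReal.toReal_ofReal (one_sub_sq_norm_pos hz).le, ENNReal.toReal_inv, ENNReal.toReal_pow,
    toReal_enorm, div_eq_mul_inv]

lemma continuousOn_poissonKernel {z : ℂ} (hz : z ∈ ball (0 : ℂ) 1) :
    ContinuousOn (poissonKernel 0 z) (sphere 0 1) := by
  simp only [funext (poissonKernel_def 0 z), sub_zero]
  refine ContinuousOn.div (by fun_prop) (by fun_prop) fun ξ hξ => ?_
  exact pow_ne_zero 2 (norm_ne_zero_iff.2 (sub_ne_zero_of_mem_sphere_of_mem_ball hξ hz))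

variable [CompleteSpace F]

lemma integral_harmonicMeasure_of_diffContOnCl {h : ℂ → F} (hh : DiffContOnCl ℂ h (ball 0 1))
    {z : ℂ} (hz : z ∈ ball (0 : ℂ) 1) : ∫ ξ, h ξ ∂harmonicMeasure z = h z := by
  have hc : ContinuousOn h (sphere 0 1) := hh.continuousOn_ball.mono sphere_subset_closedBall
  rw [integral_harmonicMeasure hz, integral_lebCircle ((continuousOn_poissonKernel hz).smul hc),
    hh.circleAverage_poissonKernel_smul hz]

lemma integral_harmonicMeasure_of_tendsto_radial {h g : ℂ → F}
    (hh : DifferentiableOn ℂ h (ball 0 1)) {C : ℝ} (hC : ∀ z ∈ ball (0 : ℂ) 1, ‖h z‖ ≤ C)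
    (hg : ∀ᵐ ξ ∂lebCircle, Tendsto (fun r : ℝ => h (r * ξ)) (𝓝[<] 1) (𝓝 (g ξ)))
    {z : ℂ} (hz : z ∈ ball (0 : ℂ) 1) : ∫ ξ, g ξ ∂harmonicMeasure z = h z := by
  have := isFiniteMeasure_harmonicMeasure hz
  have hac := harmonicMeasure_absolutelyContinuous z
  have hcl : ∀ r ∈ Set.Ioo (0 : ℝ) 1, DiffContOnCl ℂ (fun ξ => h (r * ξ)) (ball 0 1) := by
    intro r hr
    apply DifferentiableOn.diffContOnCl
    rw [closure_ball 0 one_ne_zero]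
    exact hh.comp (by fun_prop) fun ξ hξ => mul_mem_ball hr (mem_closedBall_zero_iff.1 hξ)
  have hboundary : Tendsto (fun r : ℝ => ∫ ξ, h (r * ξ) ∂harmonicMeasure z) (𝓝[<] 1)
      (𝓝 (∫ ξ, g ξ ∂harmonicMeasure z)) := by
    refine tendsto_integral_filter_of_dominated_convergence (fun _ => C) ?_ ?_
      (integrable_const _) (hac.ae_le hg)
    · filter_upwards [Ioo_mem_nhdsLT zero_lt_one] with r hr
      exact (aestronglyMeasurable_lebCircle
        ((hcl r hr).continuousOn_ball.mono sphere_subset_closedBall)).mono_ac hac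
    · filter_upwards [Ioo_mem_nhdsLT zero_lt_one] with r hr
      filter_upwards [hac.ae_le ae_mem_sphere] with ξ hξ
      exact hC _ (mul_mem_ball hr (mem_sphere_zero_iff_norm.1 hξ).le)
  have hinterior : Tendsto (fun r : ℝ => h (r * z)) (𝓝[<] 1) (𝓝 (h z)) :=
    (hh.continuousOn.continuousAt (isOpen_ball.mem_nhds hz)).tendsto.comp (hasRadialLimit_id z)
  refine tendsto_nhds_unique hboundary (hinterior.congr' ?_)
  filter_upwards [Ioo_mem_nhdsLT zero_lt_one] with r hr
  exact (integral_harmonicMeasure_of_diffContOnCl (hcl r hr) hz).symm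

end PoissonFormula

/-! ### Löwner's lemma -/

lemma integral_pow_harmonicMeasure {f g : ℂ → ℂ} (hf : DifferentiableOn ℂ f (ball 0 1))
    (hm : Set.MapsTo f (ball 0 1) (ball 0 1)) (hg : ∀ᵐ ξ ∂lebCircle, HasRadialLimit f ξ (g ξ))
    {z : ℂ} (hz : z ∈ ball (0 : ℂ) 1) (n : ℕ) : ∫ ξ, g ξ ^ n ∂harmonicMeasure z = f z ^ n := by
  refine integral_harmonicMeasure_of_tendsto_radial (h := fun z => f z ^ n) (C := 1) (hf.pow n)
    (fun w hw => ?_) (hg.mono fun ξ hξ => Tendsto.pow hξ n) hz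
  rw [norm_pow]
  exact pow_le_one₀ (norm_nonneg _) (mem_ball_zero_iff.1 (hm hw)).le

/-- The boundary map `ξ ↦ lim_{r → 1} f (r ξ)` as a total function; its value is junk where the
radial limit does not exist. -/
noncomputable def radialLimit (f : ℂ → ℂ) (ξ : ℂ) : ℂ :=
  limUnder (𝓝[<] (1 : ℝ)) fun r : ℝ => f ((r : ℂ) * ξ)

lemma HasRadialLimit.radialLimit_eq {f : ℂ → ℂ} {ξ w : ℂ} (h : HasRadialLimit f ξ w) :
    radialLimit f ξ = w :=
  Tendsto.limUnder_eq h

lemma IsInner.ae_hasRadialLimit {f : ℂ → ℂ} (hf : IsInner f) :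
    ∀ᵐ ξ ∂lebCircle, HasRadialLimit f ξ (radialLimit f ξ) ∧ radialLimit f ξ ∈ sphere (0 : ℂ) 1 := by
  filter_upwards [hf.radial] with ξ ⟨w, hw, h⟩
  rw [h.radialLimit_eq]
  exact ⟨h, hw⟩

lemma IsInner.aemeasurable_radialLimit {f : ℂ → ℂ} (hf : IsInner f) :
    AEMeasurable (radialLimit f) lebCircle := by
  classical
  have hm : Measurable ((ball (0 : ℂ) 1).piecewise f 0) :=
    hf.differentiableOn.continuousOn.measurable_piecewise continuousOn_const measurableSet_ball
  refine aemeasurable_of_tendsto_metrizable_ae (𝓝[<] (1 : ℝ))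
    (f := fun (r : ℝ) ξ => (ball (0 : ℂ) 1).piecewise f 0 (r * ξ))
    (fun r => (hm.comp (measurable_const_mul (r : ℂ))).aemeasurable) ?_
  filter_upwards [hf.ae_hasRadialLimit, ae_mem_sphere] with ξ h hξ
  refine Tendsto.congr' ?_ h.1
  filter_upwards [eventually_mul_mem_ball hξ] with r hr
  rw [Set.piecewise_eq_of_mem _ _ _ hr]

theorem IsInner.map_harmonicMeasure {f : ℂ → ℂ} (hf : IsInner f) {z : ℂ}
    (hz : z ∈ ball (0 : ℂ) 1) :
    (harmonicMeasure z).map (radialLimit f) = harmonicMeasure (f z) := by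
  have hfz := hf.mapsTo hz
  have := isFiniteMeasure_harmonicMeasure hz
  have := isFiniteMeasure_harmonicMeasure hfz
  have hac := harmonicMeasure_absolutelyContinuous z
  have hg : AEMeasurable (radialLimit f) (harmonicMeasure z) :=
    hf.aemeasurable_radialLimit.mono_ac hac
  refine measure_ext_of_integral_pow ?_
    ((harmonicMeasure_absolutelyContinuous (f z)).ae_le ae_mem_sphere) fun n => ?_
  · rw [ae_map_iff (p := (· ∈ sphere (0 : ℂ) 1)) hg isClosed_sphere.measurableSet]
    exact hac.ae_le (hf.ae_hasRadialLimit.mono fun ξ h => h.2)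
  · rw [integral_map hg (by fun_prop),
      integral_pow_harmonicMeasure hf.differentiableOn hf.mapsTo
        (hf.ae_hasRadialLimit.mono fun ξ h => h.1) hz,
      integral_pow_harmonicMeasure (f := fun z => z) (g := fun z => z) differentiableOn_id
        (Set.mapsTo_id _) (ae_of_all _ hasRadialLimit_id) hfz]

lemma IsInner.boundaryPreimage_ae_eq {f : ℂ → ℂ} (hf : IsInner f) (E : Set ℂ) :
    boundaryPreimage f E =ᵐ[lebCircle] radialLimit f ⁻¹' E := by
  filter_upwards [hf.ae_hasRadialLimit, ae_mem_sphere] with ξ h hξ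
  refine propext ⟨?_, fun hE => ⟨hξ, _, hE, h.1⟩⟩
  rintro ⟨-, w, hw, hw'⟩
  exact (congrArg (· ∈ E) hw'.radialLimit_eq).mpr hw

lemma IsInner.map_lebCircle_absolutelyContinuous {f : ℂ → ℂ} (hf : IsInner f) :
    lebCircle.map (radialLimit f) ≪ lebCircle := by
  rw [← harmonicMeasure_zero, hf.map_harmonicMeasure (by simp), harmonicMeasure_zero]
  exact harmonicMeasure_absolutelyContinuous _

lemma IsInner.nullMeasurableSet_boundaryPreimage {f : ℂ → ℂ} (hf : IsInner f) {E : Set ℂ}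
    (hE : NullMeasurableSet E lebCircle) :
    NullMeasurableSet (boundaryPreimage f E) lebCircle := by
  have hg := hf.aemeasurable_radialLimit
  have hqmp : Measure.QuasiMeasurePreserving (hg.mk _) lebCircle lebCircle :=
    ⟨hg.measurable_mk, Measure.map_congr hg.ae_eq_mk ▸ hf.map_lebCircle_absolutelyContinuous⟩
  exact (hE.preimage hqmp).congr
    ((hf.boundaryPreimage_ae_eq E).trans (hg.ae_eq_mk.preimage E)).symm

lemma IsInner.harmonicMeasure_boundaryPreimage {f : ℂ → ℂ} (hf : IsInner f) {E : Set ℂ}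
    (hE : NullMeasurableSet E lebCircle) {z : ℂ} (hz : z ∈ ball (0 : ℂ) 1) :
    harmonicMeasure z (boundaryPreimage f E) = harmonicMeasure (f z) E := by
  have hac := harmonicMeasure_absolutelyContinuous z
  have hmap := hf.map_harmonicMeasure hz
  have hE' := hE.mono_ac (harmonicMeasure_absolutelyContinuous (f z))
  rw [measure_congr (hac.ae_eq (hf.boundaryPreimage_ae_eq E)), ← hmap,
    Measure.map_apply₀ (hf.aemeasurable_radialLimit.mono_ac hac) (hmap ▸ hE')]

lemma IsInner.muMeasure_boundaryPreimage {f : ℂ → ℂ} (hf : IsInner f) {E : Set ℂ}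
    (hE : NullMeasurableSet E lebCircle) {z : ℂ} (hz : z ∈ ball (0 : ℂ) 1) :
    muMeasure z (boundaryPreimage f E) =
      ENNReal.ofReal (juliaQuotient f z) * muMeasure (f z) E := by
  have hpos := one_sub_sq_norm_pos hz
  have h := hf.harmonicMeasure_boundaryPreimage hE hz
  simp only [harmonicMeasure, Measure.smul_apply, smul_eq_mul] at h
  rw [juliaQuotient, ENNReal.ofReal_div_of_pos hpos, ENNReal.div_eq_inv_mul, mul_assoc, ← h,
    ← mul_assoc, ENNReal.inv_mul_cancel (ENNReal.ofReal_pos.2 hpos).ne' ENNReal.ofReal_ne_top,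
    one_mul]

/-! ### Boundary behaviour of the measures `muMeasure` -/

lemma continuous_inv_sq_enorm_sub (ξ : ℂ) : Continuous fun z : ℂ => (‖ξ - z‖ₑ ^ 2)⁻¹ :=
  continuous_inv.comp ((ENNReal.continuous_pow 2).comp (continuous_const.sub continuous_id).enorm)

lemma lowerSemicontinuous_muMeasure (A : Set ℂ) : LowerSemicontinuous fun z => muMeasure z A := by
  refine lowerSemicontinuous_iff_le_liminf.2 fun z => ?_
  simp only [muMeasure, withDensity_apply']
  refine le_trans (le_of_eq ?_) (lintegral_liminf_le measurable_inv_sq_enorm_sub)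
  exact lintegral_congr fun ξ => ((continuous_inv_sq_enorm_sub ξ).tendsto z).liminf_eq.symm

lemma inv_sq_enorm_sub_le {β : ℝ} {p z ξ : ℂ} (hz : z ∈ stolzAngle β p)
    (hξ : ξ ∈ sphere (0 : ℂ) 1) :
    (‖ξ - z‖ₑ ^ 2)⁻¹ ≤ ENNReal.ofReal (1 + β) ^ 2 * (‖ξ - p‖ₑ ^ 2)⁻¹ := by
  have hz1 : 0 < 1 - ‖z‖ := by simpa using hz.1
  have hβ : 0 < β := pos_of_mul_pos_left ((norm_nonneg _).trans_lt hz.2) hz1.le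
  have hle : ‖ξ - p‖ ≤ (1 + β) * ‖ξ - z‖ := by
    calc ‖ξ - p‖ ≤ ‖ξ - z‖ + ‖z - p‖ := norm_sub_le_norm_sub_add_norm_sub ξ z p
      _ ≤ ‖ξ - z‖ + β * ‖ξ - z‖ := by grw [hz.2.le, one_sub_norm_le_norm_sub hξ]
      _ = (1 + β) * ‖ξ - z‖ := by ring
  have hle' : ‖ξ - p‖ₑ ^ 2 ≤ ENNReal.ofReal (1 + β) ^ 2 * ‖ξ - z‖ₑ ^ 2 := by
    rw [← ofReal_norm, ← ofReal_norm, ← mul_pow, ← ENNReal.ofReal_mul (by positivity)]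
    gcongr
  have hβ0 : ENNReal.ofReal (1 + β) ^ 2 ≠ 0 :=
    pow_ne_zero 2 (ENNReal.ofReal_pos.2 (by positivity)).ne'
  have hβt : ENNReal.ofReal (1 + β) ^ 2 ≠ ∞ := ENNReal.pow_ne_top ENNReal.ofReal_ne_top
  calc (‖ξ - z‖ₑ ^ 2)⁻¹
      = ENNReal.ofReal (1 + β) ^ 2 * (ENNReal.ofReal (1 + β) ^ 2 * ‖ξ - z‖ₑ ^ 2)⁻¹ := by
        rw [ENNReal.mul_inv (Or.inl hβ0) (Or.inl hβt), ← mul_assoc,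
          ENNReal.mul_inv_cancel hβ0 hβt, one_mul]
    _ ≤ ENNReal.ofReal (1 + β) ^ 2 * (‖ξ - p‖ₑ ^ 2)⁻¹ := by gcongr

lemma tendsto_muMeasure (β : ℝ) (p : ℂ) (A : Set ℂ) :
    Tendsto (fun z => muMeasure z A) (𝓝[stolzAngle β p] p) (𝓝 (muMeasure p A)) := by
  by_cases htop : muMeasure p A = ∞
  · rw [htop]
    refine tendsto_order.2 ⟨fun a ha => ?_, fun a ha => absurd ha not_top_lt⟩
    exact nhdsWithin_le_nhds (lowerSemicontinuous_muMeasure A p a (ha.trans_eq htop.symm))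
  simp only [muMeasure, withDensity_apply'] at htop ⊢
  refine tendsto_lintegral_filter_of_dominated_convergence
    (fun ξ => ENNReal.ofReal (1 + β) ^ 2 * (‖ξ - p‖ₑ ^ 2)⁻¹)
    (Eventually.of_forall measurable_inv_sq_enorm_sub) ?_ ?_
    (ae_of_all _ fun ξ => ((continuous_inv_sq_enorm_sub ξ).tendsto p).mono_left nhdsWithin_le_nhds)
  · filter_upwards [self_mem_nhdsWithin] with z hz
    exact ae_restrict_of_ae (ae_mem_sphere.mono fun ξ hξ => inv_sq_enorm_sub_le hz hξ)
  · rw [lintegral_const_mul _ (measurable_inv_sq_enorm_sub p)]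
    exact ENNReal.mul_ne_top (ENNReal.pow_ne_top ENNReal.ofReal_ne_top) htop

lemma tendsto_ofReal_juliaQuotient_mul_muMeasure {f : ℂ → ℂ}
    (hf : DifferentiableOn ℂ f (ball 0 1)) (hm : Set.MapsTo f (ball 0 1) (ball 0 1)) {p q : ℂ}
    (hp : p ∈ sphere (0 : ℂ) 1) (hpq : HasRadialLimit f p q) (E : Set ℂ) :
    Tendsto (fun r : ℝ => ENNReal.ofReal (juliaQuotient f (r * p)) * muMeasure (f (r * p)) E)
      (𝓝[<] 1) (𝓝 (absAngularDeriv f p * muMeasure q E)) := by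
  have hquot := tendsto_juliaQuotient_absAngularDeriv hf hm hp
  by_cases hfin : absAngularDeriv f p = ∞
  · rcases eq_or_ne (muMeasure q E) 0 with hzero | hpos
    · have hnull (z : ℂ) : muMeasure z E = 0 :=
        muMeasure_absolutelyContinuous z (lebCircle_absolutelyContinuous q hzero)
      simp only [hnull, mul_zero]
      exact tendsto_const_nhds
    · obtain ⟨m, hm0, hmq⟩ := exists_between (pos_iff_ne_zero.2 hpos)
      have hlower : ∀ᶠ r : ℝ in 𝓝[<] 1, m < muMeasure (f (r * p)) E :=
        hpq (lowerSemicontinuous_muMeasure E q m hmq)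
      have htop := ENNReal.Tendsto.mul_const (b := m) hquot (Or.inr hmq.ne_top)
      rw [hfin, ENNReal.top_mul hm0.ne'] at htop
      rw [hfin, ENNReal.top_mul hpos]
      refine tendsto_nhds_top_mono htop ?_
      filter_upwards [hlower] with r hr
      gcongr
  · obtain ⟨η, hη, hpη, hc, heq⟩ := exists_absAngularDeriv_eq_ofReal_inv_clarkMass hf hm hp hfin
    obtain rfl : η = q := tendsto_nhds_unique hpη hpq
    have hmu : Tendsto (fun r : ℝ => muMeasure (f (r * p)) E) (𝓝[<] 1) (𝓝 (muMeasure η E)) :=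
      (tendsto_muMeasure 2 η E).comp (tendsto_radius_stolzAngle_of_clarkMass_pos hf hm hp hη hc)
    refine ENNReal.Tendsto.mul hquot (Or.inl ?_) hmu (Or.inr hfin)
    rw [heq]
    exact (ENNReal.ofReal_pos.2 (inv_pos.2 hc)).ne'

end InnerFun

open InnerFun in
theorem theorem1_general {f : ℂ → ℂ} (hf : IsInner f) {p q : ℂ} (hp : p ∈ sphere (0 : ℂ) 1)
    (hpq : HasRadialLimit f p q) {E : Set ℂ} (hE : NullMeasurableSet E lebCircle) :
    NullMeasurableSet (boundaryPreimage f E) lebCircle ∧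
      muMeasure p (boundaryPreimage f E) = absAngularDeriv f p * muMeasure q E := by
  refine ⟨hf.nullMeasurableSet_boundaryPreimage hE, ?_⟩
  have hlim := (tendsto_muMeasure 2 p (boundaryPreimage f E)).comp
    (tendsto_radius_stolzAngle hp one_lt_two)
  refine tendsto_nhds_unique hlim ((tendsto_ofReal_juliaQuotient_mul_muMeasure hf.differentiableOn
    hf.mapsTo hp hpq E).congr' ?_)
  filter_upwards [eventually_mul_mem_ball hp] with r hr
  exact (hf.muMeasure_boundaryPreimage hE hr).symm

theorem theorem1 (f : ℂ → ℂ) (hf : InnerFun.IsInner f)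
    (p : ℂ) (hp : p ∈ Metric.sphere (0 : ℂ) 1)
    -- `p` is a boundary Fatou point of `f`, with boundary value `q = f(p)` on the unit circle
    (q : ℂ) (hq : q ∈ Metric.sphere (0 : ℂ) 1) (hpq : InnerFun.HasRadialLimit f p q)
    (E : Set ℂ) (hE : E ⊆ Metric.sphere (0 : ℂ) 1)
    (hEm : NullMeasurableSet E InnerFun.lebCircle) :
    NullMeasurableSet (InnerFun.boundaryPreimage f E) InnerFun.lebCircle ∧
    (InnerFun.absAngularDeriv f p < ∞ →
      InnerFun.muMeasure p (InnerFun.boundaryPreimage f E) =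
        InnerFun.absAngularDeriv f p * InnerFun.muMeasure q E) ∧
    (InnerFun.absAngularDeriv f p = ∞ →
      (0 < InnerFun.muMeasure q E →
        InnerFun.muMeasure p (InnerFun.boundaryPreimage f E) = ∞) ∧
      (InnerFun.muMeasure q E = 0 →
        InnerFun.muMeasure p (InnerFun.boundaryPreimage f E) = 0)) := by
  obtain ⟨hmeas, hmu⟩ := theorem1_general hf hp hpq hEm
  refine ⟨hmeas, fun _ => hmu, fun htop => ?_⟩
  rw [hmu, htop]
  exact ⟨fun hpos => ENNReal.top_mul hpos.ne', fun hzero => by rw [hzero, mul_zero]⟩
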